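/- Let $(K,d)$ be a complete metric space with its Borel $\sigma$-algebra, and let $D_R=(K,w'_{e'},p'_{e'})_{e'\in E'}$ be a random dynamical system: $E'$ is at most countable, $w'_{e'}:K\to K$ and $p'_{e'}:K\to[0,1]$ are Borel measurable, and $\sum_{e'\in E'}p'_{e'}(x)=1$ for all $x\in K$. Suppose that $D_R$ has a Markov partition: there are $N\subset\mathbb N$ with $1\in N$ and a partition $(K_j)_{j\in N}$ of $K$ into non-empty Borel sets such that the restrictions of the maps and probability functions of $D_R$ to the sets $K_j$ (those whose probability function is not identically zero on $K_j$, re-indexed by a set $E$) form a countable Markov system $\mathcal M=(K_{i(e)},w_e,p_e)_{e\in E}$. That is, $E$ is at most countable, there are maps $i,t:E\to N$ with $i$ surjective, and there are Borel measurable $w_e:K_{i(e)}\to K_{t(e)}$ and $p_e:K_{i(e)}\to[0,1]$ such that $p_e$ is not identically zero and $\sum_{e:\,i(e)=j}p_e(y)=1$ for all $y\in K_j$, $j\in N$; and there is a map $c:E\to E'$ with $w_e=w'_{c(e)}|_{K_{i(e)}}$ and $p_e=p'_{c(e)}|_{K_{i(e)}}$, such that $e\mapsto(c(e),i(e))$ is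 a bijection of $E$ onto the set of all pairs $(e',j)$ for which $p'_{e'}$ does not vanish identically on $K_j$. Extend each $p_e$ to $K$ by zero and each $w_e$ arbitrarily. For $f\ge 0$ Borel, put $Uf=\sum_{e\in E}p_e\cdot(f\circ w_e)$. A Borel probability measure $\mu$ on $K$ is invariant if $\int Uf\,d\mu=\int f\,d\mu$ for all bounded Borel $f\ge0$. Let $\bar E=E\cup\{\infty\}$ be the one-point compactification of the discrete set $E$, with $i(\infty)=t(\infty)=1$, and let $\bar\Sigma=\bar E^{\mathbb Z}$, with the product topology, its Borel $\sigma$-algebra and the left shift $S$. Let $\mathcal F$ be the $\sigma$-algebra on $\bar\Sigma$ generated by the coordinates $\sigma_m$, $m\le 0$, let ${}_1[e]=\{\sigma\in\bar\Sigma:\sigma_1=e\}$, let $\Sigma_G=\{\sigma\in\bar\Sigma:\sigma_n\in E,\ i(\sigma_{n+1})=t(\sigma_n)\text{ for all }n\in\mathbb Z\}$, and let $T_j=\{\sigma\in\Sigma_G:t(\sigma_0)=j\}$. Fix points $x_j\in K_j$, $j\in N$. Let $D$ be the set of all $\sigma\in\Sigma_G$ for which $\lim_{m\to-\infty}w_{\sigma_0}\circ\dots\circ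 w_{\sigma_m}(x_{i(\sigma_m)})$ exists, and let $F:\bar\Sigma\to K$ be the coding map: $F(\sigma)$ is this limit if $\sigma\in D$, and $F(\sigma)=x_{t(\sigma_0)}$ otherwise. For a measure $\Lambda$ on $\bar\Sigma$ put $F(\Lambda)(B)=\Lambda(F^{-1}(B))$ for Borel $B\subset K$. Suppose that each $w'_{e'}$ and each $p'_{e'}$ is continuous on $K$; that $\mathcal M$ is uniformly continuous, i.e. $w_e|_{K_{i(e)}}$ and $p_e|_{K_{i(e)}}$ are uniformly continuous for every $e\in E$; and that $\mathcal M$ has a dominating Markov chain, i.e. $\sum_{e:\,i(e)=j}\sup_{x\in K_j}p_e(x)<\infty$ for every $j\in N$. Let $\bar p_e$ be the continuous extension of $p_e|_{K_{i(e)}}$ to the closure of $K_{i(e)}$, extended further to $K$ by zero. An asymptotic state of $\mathcal M$ is a shift-invariant Borel probability measure $\Lambda$ on $\bar\Sigma$ with $\Lambda(D)=1$ and $$E_\Lambda\left(1_{{}_1[e]}\,\middle|\,\mathcal F\right)=(\bar p_e\circ F)\,1_{T_{i(e)}}\quad\Lambda\text{-a.e., for all }e\in E.$$ Then $\mathcal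 M$ is consistent: for every asymptotic state $\Lambda$ of $\mathcal M$, the measure $F(\Lambda)$ is an invariant Borel probability measure. -/

import Mathlib

open MeasureTheory Filter Topology
open scoped ENNReal

noncomputable section

/-! ## Random dynamical systems and Markov systems -/

/-- A random dynamical system `(K, w_e, p_e)_{e ∈ E'}`: countably many Borel maps `w e : K → K`
together with Borel probability functions `p e : K → [0, 1]` which sum to one at every point. -/
structure RandomDynamicalSystem (K E' : Type*) [MeasurableSpace K] where
  w : E' → K → K
  p : E' → K → ℝ
  countable_index : Countable E'
  measurable_w : ∀ e, Measurable (w e)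
  measurable_p : ∀ e, Measurable (p e)
  p_mem : ∀ e x, p e x ∈ Set.Icc (0 : ℝ) 1
  hasSum_p : ∀ x, HasSum (fun e => p e x) 1

/-- The maps and the probability functions of the random dynamical system are continuous. -/
def RandomDynamicalSystem.IsContinuous {K E' : Type*} [TopologicalSpace K] [MeasurableSpace K]
    (R : RandomDynamicalSystem K E') : Prop :=
  ∀ e, Continuous (R.w e) ∧ Continuous (R.p e)

/-- A countable Markov system `(K_{i(e)}, w_e, p_e)_{e ∈ E}`. The vertex sets `V j`, `j ∈ N ⊆ ℕ`,
form a partition of `K` into non-empty Borel sets, `i` and `t` are the initial and the terminal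
vertex of an edge. `w e` and `p e` matter on `V (i e)` only: `p e` is extended to `K` by zero and
`w e` arbitrarily. -/
structure MarkovSystem (K E : Type*) [MeasurableSpace K] (N : Set ℕ) where
  one_mem : 1 ∈ N
  countable_index : Countable E
  V : N → Set K
  V_nonempty : ∀ j, (V j).Nonempty
  V_measurable : ∀ j, MeasurableSet (V j)
  V_disjoint : Pairwise fun j k => Disjoint (V j) (V k)
  V_cover : ⋃ j, V j = Set.univ
  i : E → N
  t : E → N
  i_surjective : Function.Surjective i
  w : E → K → K
  p : E → K → ℝ
  w_mapsTo : ∀ e, Set.MapsTo (w e) (V (i e)) (V (t e))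
  w_measurable : ∀ e, Measurable fun x : V (i e) => w e x
  p_measurable : ∀ e, Measurable fun x : V (i e) => p e x
  p_mem : ∀ e, ∀ x ∈ V (i e), p e x ∈ Set.Icc (0 : ℝ) 1
  p_eq_zero : ∀ e, ∀ x ∉ V (i e), p e x = 0
  p_pos : ∀ e, ∃ x ∈ V (i e), 0 < p e x
  hasSum_p : ∀ j, ∀ x ∈ V j, HasSum (fun e : {e : E // i e = j} => p e x) 1

/-- The Markov operator `U f = ∑ e, p_e · (f ∘ w_e)` on non-negative functions. -/
def markovOperator {K E : Type*} (w : E → K → K) (p : E → K → ℝ) (f : K → ℝ≥0∞) : K → ℝ≥0∞ :=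
  fun x => ∑' e, ENNReal.ofReal (p e x) * f (w e x)

/-! ## The code space -/

/-- The alphabet `E ∪ {∞}`, the one-point compactification of the discrete set `E`. -/
def Letter (E : Type*) : Type _ := OnePoint E

namespace Letter

/-- A letter of `E`, as an element of `E ∪ {∞}`. -/
def of {E : Type*} (e : E) : Letter E := OnePoint.some e

/-- The topology of the one-point compactification, for the discrete topology on `E`. -/
instance {E : Type*} : TopologicalSpace (Letter E) :=
  letI : TopologicalSpace E := ⊥
  inferInstanceAs (TopologicalSpace (OnePoint E))

/-- All subsets of `E ∪ {∞}` are measurable (for countable `E` these are the Borel sets). -/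
instance {E : Type*} : MeasurableSpace (Letter E) := ⊤

instance {E : Type*} [Countable E] : Countable (Letter E) :=
  inferInstanceAs (Countable (Option E))

instance {E : Type*} : T2Space (Letter E) :=
  letI : TopologicalSpace E := ⊥
  haveI : DiscreteTopology E := ⟨rfl⟩
  inferInstanceAs (T2Space (OnePoint E))

instance {E : Type*} [Countable E] : FirstCountableTopology (Letter E) := by
  let _ : TopologicalSpace E := ⊥
  have _ : DiscreteTopology E := ⟨rfl⟩
  suffices h : FirstCountableTopology (OnePoint E) from h
  have hc : (cofinite : Filter E).IsCountablyGenerated :=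
    Filter.HasCountableBasis.isCountablyGenerated
      ⟨Filter.hasBasis_cofinite, Set.Countable.ofPred_finite⟩
  refine ⟨fun a => ?_⟩
  induction a with
  | infty =>
    rw [OnePoint.nhds_infty_eq, coclosedCompact_eq_cocompact, cocompact_eq_cofinite]
    infer_instance
  | coe a =>
    rw [OnePoint.nhds_coe_eq, nhds_discrete]
    infer_instance

instance {E : Type*} [Countable E] : BorelSpace (Letter E) := by
  refine ⟨le_antisymm (fun s _ => ?_) le_top⟩
  let _ : MeasurableSpace (Letter E) := borel (Letter E)
  have _ : BorelSpace (Letter E) := ⟨rfl⟩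
  exact s.to_countable.measurableSet

end Letter

/-- The code space: two-sided sequences in `E ∪ {∞}`, with the product topology and the product
`σ`-algebra (for countable `E` this is the Borel `σ`-algebra, see the fact below). -/
abbrev CodeSpace (E : Type*) : Type _ := ℤ → Letter E

theorem CodeSpace.borelSpace {E : Type*} [Countable E] : BorelSpace (CodeSpace E) :=
  inferInstance

namespace CodeSpace

variable {E : Type*}

/-- The left shift. -/
def shift (σ : CodeSpace E) : CodeSpace E := fun n => σ (n + 1)

/-- The cylinder set `_m[a_m, …, a_n]`. -/
def cylinder (m n : ℤ) (a : ℤ → Letter E) : Set (CodeSpace E) :=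
  {σ | ∀ k, m ≤ k → k ≤ n → σ k = a k}

/-- The `σ`-algebra `𝓕` of the past, generated by the cylinder sets `_m[a_m, …, a_0]`,
`m ≤ 0`. -/
@[reducible] def past (E : Type*) : MeasurableSpace (CodeSpace E) :=
  MeasurableSpace.generateFrom {A | ∃ m : ℤ, m ≤ 0 ∧ ∃ a : ℤ → Letter E, A = cylinder m 0 a}

theorem past_le : past E ≤ MeasurableSpace.pi := by
  refine MeasurableSpace.generateFrom_le ?_
  rintro _ ⟨m, -, a, rfl⟩
  have : cylinder m 0 a = ⋂ k : ℤ, ⋂ _ : m ≤ k, ⋂ _ : k ≤ 0,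
      (fun σ : CodeSpace E => σ k) ⁻¹' {a k} := by
    ext σ
    simp [cylinder]
  rw [this]
  exact MeasurableSet.iInter fun k => MeasurableSet.iInter fun _ => MeasurableSet.iInter fun _ =>
    measurable_pi_apply k (by trivial)

/-- The set `_1[e]` of all codes whose entry at time `1` is `e`. -/
def nextIs (e : E) : Set (CodeSpace E) := cylinder 1 1 fun _ => Letter.of e

end CodeSpace

namespace MarkovSystem

open CodeSpace

variable {K E : Type*} [MeasurableSpace K] {N : Set ℕ} (M : MarkovSystem K E N)

/-- The initial vertex of a letter, with `i(∞) = 1`. -/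
def iExt (a : Letter E) : N := OnePoint.elim a ⟨1, M.one_mem⟩ M.i

/-- The terminal vertex of a letter, with `t(∞) = 1`. -/
def tExt (a : Letter E) : N := OnePoint.elim a ⟨1, M.one_mem⟩ M.t

/-- The map of a letter, with `w_∞ = id`. -/
def wExt (a : Letter E) : K → K := OnePoint.elim a id M.w

/-- The path space `Σ_G`. -/
def pathSpace : Set (CodeSpace E) :=
  {σ | ∀ n, M.iExt (σ (n + 1)) = M.tExt (σ n) ∧ ∃ e : E, σ n = Letter.of e}

/-- The set `T_j` of the paths which are at the vertex `j` after time `0`. -/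
def arrivesAt (j : N) : Set (CodeSpace E) := {σ | σ ∈ M.pathSpace ∧ M.tExt (σ 0) = j}

/-- `M.backward σ n = w_{σ_0} ∘ w_{σ_{-1}} ∘ ⋯ ∘ w_{σ_{-n}}`. -/
def backward (M : MarkovSystem K E N) (σ : CodeSpace E) : ℕ → K → K
  | 0 => M.wExt (σ 0)
  | n + 1 => backward M σ n ∘ M.wExt (σ (-((n : ℤ) + 1)))

/-- The set `D` of the paths `σ` along which `w_{σ_0} ∘ ⋯ ∘ w_{σ_m} (x_{i(σ_m)})` converges as
`m → -∞`, for the chosen base points `x_j ∈ V j`. -/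
def convergenceSet [TopologicalSpace K] (x : ∀ j, M.V j) : Set (CodeSpace E) :=
  {σ | σ ∈ M.pathSpace ∧ ∃ y : K,
    Tendsto (fun n : ℕ => M.backward σ n (x (M.iExt (σ (-(n : ℤ)))))) atTop (𝓝 y)}

open Classical in
/-- The coding map `F`: the above limit on `D`, and `x_{t(σ_0)}` elsewhere. -/
def codingMap [TopologicalSpace K] (x : ∀ j, M.V j) (σ : CodeSpace E) : K :=
  if h : σ ∈ M.convergenceSet x then h.2.choose else x (M.tExt (σ 0))

/-- The continuous extension of `p_e` from `V (i e)` to its closure, extended further by zero. -/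
def pBar [TopologicalSpace K] (e : E) : K → ℝ :=
  (closure (M.V (M.i e))).indicator (extendFrom (M.V (M.i e)) (M.p e))

/-- The asymptotic states of the Markov system: shift-invariant Borel probability measures `Λ` on
the code space with `Λ(D) = 1` and `E_Λ(1_{_1[e]} | 𝓕) = (pBar e ∘ F) · 1_{T_{i(e)}}` almost
everywhere, for all edges `e`. -/
structure IsAsymptoticState [TopologicalSpace K] (x : ∀ j, M.V j)
    (Λ : Measure (CodeSpace E)) : Prop where
  isProbabilityMeasure : IsProbabilityMeasure Λ
  shift_invariant : MeasurePreserving shift Λ Λ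
  convergence : Λ (M.convergenceSet x) = 1
  condExp_eq : ∀ e : E,
    Λ[(nextIs e).indicator (fun _ => (1 : ℝ)) | past E] =ᵐ[Λ]
      (M.arrivesAt (M.i e)).indicator fun σ => M.pBar e (M.codingMap x σ)

/-- `μ` is an invariant Borel probability measure: `U* μ = μ`, where
`U* μ (f) = ∫ U f dμ` for bounded non-negative Borel functions `f`. -/
def IsInvariant (μ : Measure K) : Prop :=
  IsProbabilityMeasure μ ∧
    ∀ f : K → ℝ≥0∞, Measurable f → (∃ C : ℝ≥0∞, C ≠ ∞ ∧ ∀ x, f x ≤ C) →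
      ∫⁻ x, markovOperator M.w M.p f x ∂μ = ∫⁻ x, f x ∂μ

/-- The Markov system is consistent if the coding map sends every asymptotic state to an
invariant measure. -/
def IsConsistent [TopologicalSpace K] (x : ∀ j, M.V j) : Prop :=
  ∀ Λ : Measure (CodeSpace E), M.IsAsymptoticState x Λ →
    M.IsInvariant (Λ.map (M.codingMap x))

/-- Each `w_e` and each `p_e` is uniformly continuous on `V (i e)`. -/
def IsUniformlyContinuous [UniformSpace K] : Prop :=
  ∀ e, UniformContinuousOn (M.w e) (M.V (M.i e)) ∧ UniformContinuousOn (M.p e) (M.V (M.i e))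

/-- `∑_{e : i(e) = j} sup_{V j} p_e < ∞` for every vertex `j`. -/
def HasDominatingMarkovChain : Prop :=
  ∀ j : N, ∑' e : {e : E // M.i e = j}, ⨆ x ∈ M.V j, ENNReal.ofReal (M.p e x) < ∞

/-- The Markov system results from the random dynamical system `R` by restricting its maps and
probability functions to the atoms of a Markov partition, up to the indexing: the edges `e`
correspond, through `e ↦ (c e, i e)`, to the pairs of an index `e'` of `R` and a vertex `j` for
which the probability function `p_{e'}` does not vanish identically on `V j`. -/
def IsAssociatedWith {E' : Type*} (R : RandomDynamicalSystem K E') : Prop :=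
  ∃ c : E → E',
    Function.Injective (fun e => (c e, M.i e)) ∧
    (∀ e' j, (∃ y ∈ M.V j, 0 < R.p e' y) → ∃ e, c e = e' ∧ M.i e = j) ∧
    ∀ e, Set.EqOn (M.w e) (R.w (c e)) (M.V (M.i e)) ∧
      Set.EqOn (M.p e) (R.p (c e)) (M.V (M.i e))

end MarkovSystem

end

/-! ### The past σ-algebra and conditional probabilities -/

namespace CodeSpace

variable {E : Type*}

/-! On the convergence set the coding map `F` satisfies `F (S σ) = w_{σ_1} (F σ)`, because the
globally continuous maps of `R` pass to the limit (`codingMap_shift`). Shift-invariance then turns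
`∫ f ∘ F` into a sum over `e` of integrals of `f ∘ w_e ∘ F` over `_1[e]`. As `F` agrees almost
everywhere with a past-measurable map, the state condition replaces `1_{_1[e]}` by `pBar e (F)` on
the paths arriving at `i e`. It remains to see that these weights sum to `U f (F σ)`. The point `F
σ` lies only in the closure of the vertex set of `t(σ_0)`, possibly in another atom. Continuity of
the functions of `R` settles this: there `pBar e` is the function of `R`, and an index without an
edge at this vertex contributes zero (`tsum_edges_eq_markovOperator`). -/

theorem measurable_past_apply [Countable E] {k : ℤ} (hk : k ≤ 0) :
    Measurable[past E] fun σ : CodeSpace E => σ k := by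
  refine @measurable_to_countable' (Letter E) (CodeSpace E) _ _ (past E) _ fun a => ?_
  -- The generators fix all letters from `k` to `0`, so the event is split into the countably many
  -- words on that window.
  have h : (fun σ : CodeSpace E => σ k) ⁻¹' {a} =
      ⋃ b : {b : Set.Icc k 0 → Letter E // b ⟨k, le_rfl, hk⟩ = a},
        cylinder k 0 fun l => if hl : l ∈ Set.Icc k 0 then b.1 ⟨l, hl⟩ else a := by
    ext σ
    simp only [Set.mem_preimage, Set.mem_singleton_iff, Set.mem_iUnion]
    constructor
    · intro h
      refine ⟨⟨fun l => σ l, h⟩, fun l h1 h2 => ?_⟩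
      simp [h1, h2]
    · rintro ⟨⟨b, hb⟩, h⟩
      simpa [hk, hb] using h k le_rfl hk
  rw [h]
  exact MeasurableSet.iUnion fun b => MeasurableSpace.measurableSet_generateFrom ⟨k, hk, _, rfl⟩

theorem mem_nextIs {σ : CodeSpace E} {e : E} : σ ∈ nextIs e ↔ σ 1 = Letter.of e :=
  ⟨fun h => h 1 le_rfl le_rfl, fun h _ h1 h2 => le_antisymm h2 h1 ▸ h⟩

theorem measurableSet_nextIs (e : E) : MeasurableSet (nextIs e) := by
  have h : nextIs e = (fun σ : CodeSpace E => σ 1) ⁻¹' {Letter.of e} := Set.ext fun _ => mem_nextIs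
  rw [h]
  exact measurable_pi_apply 1 (by trivial)

end CodeSpace

/-- The conditional probability of `A` integrates `m`-measurable functions like `1_A`. -/
theorem lintegral_mul_condExp_indicator {Ω : Type*} {m m₀ : MeasurableSpace Ω} (hm : m ≤ m₀)
    (μ : Measure Ω) [IsFiniteMeasure μ] {A : Set Ω} (hA : MeasurableSet A) {g : Ω → ℝ≥0∞}
    (hg : Measurable[m] g) :
    ∫⁻ ω, ENNReal.ofReal ((μ[A.indicator (fun _ => (1 : ℝ)) | m]) ω) * g ω ∂μ =
      ∫⁻ ω in A, g ω ∂μ := by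
  set h := μ[A.indicator (fun _ => (1 : ℝ)) | m] with hh
  have hint : Integrable (A.indicator fun _ => (1 : ℝ)) μ := (integrable_const 1).indicator hA
  have hmeas : Measurable fun ω => ENNReal.ofReal (h ω) :=
    ((stronglyMeasurable_condExp.mono hm).measurable).ennreal_ofReal
  have hnn : 0 ≤ᵐ[μ] h :=
    condExp_nonneg (Eventually.of_forall fun ω => Set.indicator_nonneg (fun _ _ => zero_le_one) ω)
  -- The measure with density `h` and the restriction to `A` agree on `m`, hence integrate every
  -- `m`-measurable function alike.
  have htrim : (μ.withDensity fun ω => ENNReal.ofReal (h ω)).trim hm = (μ.restrict A).trim hm := by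
    refine @Measure.ext _ m _ _ fun s hs => ?_
    rw [trim_measurableSet_eq hm hs, trim_measurableSet_eq hm hs,
      withDensity_apply _ (hm s hs), ← ofReal_integral_eq_lintegral_ofReal
        integrable_condExp.integrableOn (ae_restrict_of_ae hnn), setIntegral_condExp hm hint hs,
      integral_indicator hA, Measure.restrict_restrict hA, integral_const, smul_eq_mul, mul_one,
      Measure.restrict_apply (hm s hs), measureReal_def, Measure.restrict_apply MeasurableSet.univ,
      Set.univ_inter, Set.inter_comm, ENNReal.ofReal_toReal (measure_ne_top _ _)]
  have hg' : Measurable g := hg.mono hm le_rfl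
  rw [← lintegral_trim hm hg, ← htrim, lintegral_trim hm hg,
    lintegral_withDensity_eq_lintegral_mul μ hmeas hg']
  rfl

theorem measurable_limUnder_of_stronglyMeasurable {Ω X : Type*} {m : MeasurableSpace Ω}
    [Nonempty X] [MetricSpace X] [CompleteSpace X] [MeasurableSpace X] [BorelSpace X]
    {u : ℕ → Ω → X} (hu : ∀ n, StronglyMeasurable (u n)) :
    Measurable fun ω => limUnder atTop fun n => u n ω :=
  (StronglyMeasurable.limUnder hu).measurable

/-! ### Backward orbits and the coding map -/

namespace MarkovSystem

open CodeSpace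

variable {K E : Type*} [MeasurableSpace K] {N : Set ℕ} (M : MarkovSystem K E N)

theorem iExt_of (e : E) : M.iExt (Letter.of e) = M.i e := rfl

theorem wExt_of (e : E) : M.wExt (Letter.of e) = M.w e := rfl

theorem backward_congr {σ τ : CodeSpace E} (n : ℕ)
    (h : ∀ k : ℤ, -(n : ℤ) ≤ k → k ≤ 0 → σ k = τ k) : M.backward σ n = M.backward τ n := by
  induction n with
  | zero => simp [backward, h 0]
  | succ n ih =>
    rw [backward, backward, ih fun k h1 h2 => h k (by push_cast; omega) h2,
      h (-((n : ℤ) + 1)) (by push_cast; omega) (by omega)]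

/-- The recursion adds maps at the remote end, while the shift adds one at the recent end; induction
reconciles the two. -/
theorem backward_shift (σ : CodeSpace E) (n : ℕ) :
    M.backward (shift σ) (n + 1) = M.wExt (σ 1) ∘ M.backward σ n := by
  induction n with
  | zero => simp [backward, shift]
  | succ n ih =>
    rw [backward, ih, backward, Function.comp_assoc]
    congr 3

theorem wExt_mapsTo {a : Letter E} (h : ∃ e, a = Letter.of e) :
    Set.MapsTo (M.wExt a) (M.V (M.iExt a)) (M.V (M.tExt a)) := by
  obtain ⟨e, rfl⟩ := h
  exact M.w_mapsTo e

theorem backward_mapsTo {σ : CodeSpace E} (hσ : σ ∈ M.pathSpace) (n : ℕ) :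
    Set.MapsTo (M.backward σ n) (M.V (M.iExt (σ (-(n : ℤ))))) (M.V (M.tExt (σ 0))) := by
  induction n with
  | zero => simpa [backward] using M.wExt_mapsTo (hσ 0).2
  | succ n ih =>
    intro y hy
    refine ih ?_
    have h := M.wExt_mapsTo (hσ (-((n : ℤ) + 1))).2
    have h1 := (hσ (-((n : ℤ) + 1))).1
    rw [show -((n : ℤ) + 1) + 1 = -(n : ℤ) by ring] at h1
    rw [h1]
    push_cast at hy
    exact h hy

/-- `w_{σ_0} ∘ ⋯ ∘ w_{σ_{-n}} (x_{i(σ_{-n})})`. -/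
def backwardOrbit (x : ∀ j, M.V j) (n : ℕ) (σ : CodeSpace E) : K :=
  M.backward σ n (x (M.iExt (σ (-(n : ℤ)))))

theorem backwardOrbit_mem (x : ∀ j, M.V j) {σ : CodeSpace E} (hσ : σ ∈ M.pathSpace) (n : ℕ) :
    M.backwardOrbit x n σ ∈ M.V (M.tExt (σ 0)) :=
  M.backward_mapsTo hσ n (x _).2

theorem backwardOrbit_shift (x : ∀ j, M.V j) (n : ℕ) (σ : CodeSpace E) :
    M.backwardOrbit x (n + 1) (shift σ) = M.wExt (σ 1) (M.backwardOrbit x n σ) := by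
  have h : shift σ (-((n + 1 : ℕ) : ℤ)) = σ (-(n : ℤ)) := congrArg σ (by push_cast; ring)
  rw [backwardOrbit, backward_shift, h]
  rfl

/-- Only finitely many letters from a countable alphabet enter, so the orbit factors through a
countable discrete space. Strong measurability matters since `K` need not be separable. -/
theorem stronglyMeasurable_backwardOrbit [TopologicalSpace K] (x : ∀ j, M.V j) (n : ℕ) :
    StronglyMeasurable[past E] (M.backwardOrbit x n) := by
  have := M.countable_index
  classical
  let fill : (Set.Icc (-(n : ℤ)) 0 → Letter E) → CodeSpace E :=
    fun b k => if hk : k ∈ Set.Icc (-(n : ℤ)) 0 then b ⟨k, hk⟩ else OnePoint.infty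
  have hres : Measurable[past E] fun (σ : CodeSpace E) (k : Set.Icc (-(n : ℤ)) 0) => σ k :=
    @measurable_pi_lambda _ _ _ (past E) _ _ fun k => measurable_past_apply k.2.2
  have heq : M.backwardOrbit x n = fun σ => M.backwardOrbit x n (fill fun k => σ k) := by
    funext σ
    have h : ∀ k : ℤ, -(n : ℤ) ≤ k → k ≤ 0 → σ k = fill (fun k => σ k) k := by
      intro k h1 h2
      simp [fill, h1, h2]
    rw [backwardOrbit, backwardOrbit, M.backward_congr n h, ← h _ le_rfl (by omega)]
  rw [heq]
  exact (StronglyMeasurable.of_discrete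
    (f := fun b => M.backwardOrbit x n (fill b))).comp_measurable hres

theorem measurableSet_pathSpace : MeasurableSet M.pathSpace := by
  have := M.countable_index
  have h : M.pathSpace = ⋂ n : ℤ, (fun σ : CodeSpace E => (σ (n + 1), σ n)) ⁻¹'
      {a | M.iExt a.1 = M.tExt a.2 ∧ ∃ e : E, a.2 = Letter.of e} := by
    ext σ
    simp [pathSpace]
  rw [h]
  exact MeasurableSet.iInter fun n =>
    ((measurable_pi_apply (n + 1)).prodMk (measurable_pi_apply n)) (MeasurableSet.of_discrete)

theorem measurableSet_convergenceSet [MetricSpace K] [CompleteSpace K] (x : ∀ j, M.V j) :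
    MeasurableSet (M.convergenceSet x) :=
  M.measurableSet_pathSpace.inter (StronglyMeasurable.measurableSet_exists_tendsto fun n =>
    (M.stronglyMeasurable_backwardOrbit x n).mono past_le)

theorem tendsto_codingMap [TopologicalSpace K] (x : ∀ j, M.V j) {σ : CodeSpace E}
    (hσ : σ ∈ M.convergenceSet x) :
    Tendsto (fun n => M.backwardOrbit x n σ) atTop (𝓝 (M.codingMap x σ)) := by
  rw [codingMap, dif_pos hσ]
  exact hσ.2.choose_spec

theorem codingMap_mem_closure [TopologicalSpace K] (x : ∀ j, M.V j) {σ : CodeSpace E}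
    (hσ : σ ∈ M.convergenceSet x) : M.codingMap x σ ∈ closure (M.V (M.tExt (σ 0))) :=
  mem_closure_of_tendsto (M.tendsto_codingMap x hσ)
    (Eventually.of_forall fun n => M.backwardOrbit_mem x hσ.1 n)

/-- The coding map agrees on the convergence set with a function measurable in the past. -/
theorem exists_measurable_past_eqOn_codingMap [MetricSpace K] [CompleteSpace K] [BorelSpace K]
    (x : ∀ j, M.V j) :
    ∃ G : CodeSpace E → K, Measurable[past E] G ∧
      Set.EqOn G (M.codingMap x) (M.convergenceSet x) := by
  have : Nonempty K := ⟨x ⟨1, M.one_mem⟩⟩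
  -- `codingMap` branches on the convergence set, which also constrains future letters; `limUnder`
  -- sees only the backward orbit.
  refine ⟨fun σ => limUnder atTop fun n => M.backwardOrbit x n σ,
    measurable_limUnder_of_stronglyMeasurable (M.stronglyMeasurable_backwardOrbit x),
    fun σ hσ => (M.tendsto_codingMap x hσ).limUnder_eq⟩

theorem shift_mem_pathSpace {σ : CodeSpace E} (hσ : σ ∈ M.pathSpace) : shift σ ∈ M.pathSpace :=
  fun n => hσ (n + 1)

/-- The limit may leave `V (i e)`, where `M.w e` is arbitrary; hence the continuous global `v`. -/
theorem tendsto_backwardOrbit_shift [TopologicalSpace K] (x : ∀ j, M.V j) {σ : CodeSpace E}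
    (hσ : σ ∈ M.convergenceSet x) {e : E} (he : σ 1 = Letter.of e) {v : K → K}
    (hv : Continuous v) (hve : Set.EqOn (M.w e) v (M.V (M.i e))) :
    Tendsto (fun n => M.backwardOrbit x n (shift σ)) atTop (𝓝 (v (M.codingMap x σ))) := by
  rw [← tendsto_add_atTop_iff_nat 1]
  refine ((hv.tendsto _).comp (M.tendsto_codingMap x hσ)).congr fun n => ?_
  have hi : M.tExt (σ 0) = M.i e := by
    rw [← M.iExt_of, ← he]
    exact (hσ.1 0).1.symm
  rw [backwardOrbit_shift, he, wExt_of, hve (hi ▸ M.backwardOrbit_mem x hσ.1 n)]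
  rfl

theorem codingMap_shift [TopologicalSpace K] [T2Space K] (x : ∀ j, M.V j) {σ : CodeSpace E}
    (hσ : σ ∈ M.convergenceSet x) {e : E} (he : σ 1 = Letter.of e) {v : K → K}
    (hv : Continuous v) (hve : Set.EqOn (M.w e) v (M.V (M.i e))) :
    shift σ ∈ M.convergenceSet x ∧ M.codingMap x (shift σ) = v (M.codingMap x σ) := by
  have h := M.tendsto_backwardOrbit_shift x hσ he hv hve
  have hD : shift σ ∈ M.convergenceSet x := ⟨M.shift_mem_pathSpace hσ.1, _, h⟩
  exact ⟨hD, tendsto_nhds_unique (M.tendsto_codingMap x hD) h⟩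

/-! ### The Markov operator on closures of vertex sets -/

theorem pBar_eq_of_continuous [TopologicalSpace K] {e : E} {q : K → ℝ} (hq : Continuous q)
    (hqe : Set.EqOn (M.p e) q (M.V (M.i e))) {y : K} (hy : y ∈ closure (M.V (M.i e))) :
    M.pBar e y = q y := by
  rw [pBar, Set.indicator_of_mem hy]
  refine extendFrom_eq hy ((hq.tendsto y).mono_left nhdsWithin_le_nhds |>.congr' ?_)
  filter_upwards [self_mem_nhdsWithin] with z hz using (hqe hz).symm

/-- On the closure of `V j`, the Markov operator of the random dynamical system is the sum over
the edges starting in `j`. -/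
theorem tsum_edges_eq_markovOperator [TopologicalSpace K] {E' : Type*}
    (R : RandomDynamicalSystem K E') (hp : ∀ e', Continuous (R.p e')) {c : E → E'}
    (hinj : Function.Injective fun e => (c e, M.i e))
    (hsurj : ∀ e' j, (∃ y ∈ M.V j, 0 < R.p e' y) → ∃ e, c e = e' ∧ M.i e = j)
    (f : K → ℝ≥0∞) {j : N} {y : K} (hy : y ∈ closure (M.V j)) {q : E → ℝ≥0∞}
    (hq : ∀ e, M.i e = j → q e = ENNReal.ofReal (R.p (c e) y) * f (R.w (c e) y))
    (hq0 : ∀ e, M.i e ≠ j → q e = 0) :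
    ∑' e, q e = markovOperator R.w R.p f y := by
  have hi : ∀ e : Function.support q, M.i e = j := fun e => by
    by_contra h
    exact e.2 (hq0 e h)
  -- `c` matches the edges with nonzero term to the indices of `R` with nonzero term.
  refine (tsum_eq_tsum_of_ne_zero_bij (fun e : Function.support q => c e) ?_ ?_ ?_).symm
  · intro e₁ e₂ h
    exact Subtype.ext (hinj (Prod.ext h ((hi e₁).trans (hi e₂).symm)))
  · intro e' he'
    have hne : ∃ z ∈ M.V j, 0 < R.p e' z := by
      -- An index vanishing on `V j` vanishes on its closure, so its term at `y` is zero.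
      by_contra! h
      have hle : R.p e' y ≤ 0 :=
        closure_minimal (t := {z | R.p e' z ≤ 0}) h
          (isClosed_le (hp e') continuous_const) hy
      exact he' (by simp [ENNReal.ofReal_of_nonpos hle])
    obtain ⟨e, rfl, he⟩ := hsurj e' j hne
    refine ⟨⟨e, ?_⟩, rfl⟩
    rw [Function.mem_support, hq e he]
    exact he'
  · intro e
    exact (hq e (hi e)).symm

theorem markovOperator_eq_of_isAssociatedWith [TopologicalSpace K] {E' : Type*}
    (R : RandomDynamicalSystem K E') (hp : ∀ e', Continuous (R.p e'))
    (hMR : M.IsAssociatedWith R) (f : K → ℝ≥0∞) :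
    markovOperator M.w M.p f = markovOperator R.w R.p f := by
  obtain ⟨c, hinj, hsurj, hc⟩ := hMR
  funext y
  obtain ⟨j, hj⟩ := Set.mem_iUnion.1 (M.V_cover ▸ Set.mem_univ y)
  refine M.tsum_edges_eq_markovOperator R hp hinj hsurj f (subset_closure hj) ?_ ?_
  · rintro e rfl
    rw [(hc e).1 hj, (hc e).2 hj]
  · intro e he
    rw [M.p_eq_zero e y fun h => Set.disjoint_left.1 (M.V_disjoint he) h hj]
    simp

theorem measurable_markovOperator {E' : Type*} (R : RandomDynamicalSystem K E') {f : K → ℝ≥0∞}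
    (hf : Measurable f) : Measurable (markovOperator R.w R.p f) := by
  have := R.countable_index
  exact Measurable.tsum fun e =>
    (R.measurable_p e).ennreal_ofReal.mul (hf.comp (R.measurable_w e))

/-! ### Invariance of the image measure -/

namespace IsAsymptoticState

variable {M}

theorem ae_mem_convergenceSet [MetricSpace K] [CompleteSpace K] {x : ∀ j, M.V j}
    {Λ : Measure (CodeSpace E)} (hΛ : M.IsAsymptoticState x Λ) :
    ∀ᵐ σ ∂Λ, σ ∈ M.convergenceSet x := by
  have := hΛ.isProbabilityMeasure
  exact (prob_compl_eq_zero_iff (M.measurableSet_convergenceSet x)).2 hΛ.convergence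

theorem aemeasurable_codingMap [MetricSpace K] [CompleteSpace K] [BorelSpace K]
    {x : ∀ j, M.V j} {Λ : Measure (CodeSpace E)} (hΛ : M.IsAsymptoticState x Λ) :
    AEMeasurable (M.codingMap x) Λ := by
  obtain ⟨G, hG, hGF⟩ := M.exists_measurable_past_eqOn_codingMap x
  refine ⟨G, hG.mono past_le le_rfl, ?_⟩
  filter_upwards [hΛ.ae_mem_convergenceSet] with σ hσ using (hGF hσ).symm

theorem lintegral_markovOperator_codingMap [MetricSpace K] [CompleteSpace K] [BorelSpace K]
    {E' : Type*} {R : RandomDynamicalSystem K E'} (hMR : M.IsAssociatedWith R)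
    (hR : R.IsContinuous) {x : ∀ j, M.V j} {Λ : Measure (CodeSpace E)}
    (hΛ : M.IsAsymptoticState x Λ) {f : K → ℝ≥0∞} (hf : Measurable f) :
    ∫⁻ σ, markovOperator R.w R.p f (M.codingMap x σ) ∂Λ = ∫⁻ σ, f (M.codingMap x σ) ∂Λ := by
  have := M.countable_index
  have := hΛ.isProbabilityMeasure
  obtain ⟨c, hinj, hsurj, hc⟩ := hMR
  obtain ⟨G, hG, hGF⟩ := M.exists_measurable_past_eqOn_codingMap x
  have hG' : Measurable G := hG.mono past_le le_rfl
  let g : E → CodeSpace E → ℝ≥0∞ := fun e σ => f (R.w (c e) (G σ))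
  have hg : ∀ e, Measurable[past E] (g e) := fun e =>
    (hf.comp (R.measurable_w (c e))).comp hG
  let q : E → CodeSpace E → ℝ := fun e => Λ[(nextIs e).indicator (fun _ => (1 : ℝ)) | past E]
  have hq : ∀ e, Measurable (q e) := fun e => (stronglyMeasurable_condExp.mono past_le).measurable
  symm
  calc ∫⁻ σ, f (M.codingMap x σ) ∂Λ
      = ∫⁻ σ, f (G σ) ∂Λ := by
        refine lintegral_congr_ae ?_
        filter_upwards [hΛ.ae_mem_convergenceSet] with σ hσ
        rw [hGF hσ]
    _ = ∫⁻ σ, f (G (shift σ)) ∂Λ := (hΛ.shift_invariant.lintegral_comp (hf.comp hG')).symm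
    -- On a path exactly one edge occurs at time `1`, so a single summand survives.
    _ = ∫⁻ σ, ∑' e, (nextIs e).indicator (g e) σ ∂Λ := by
        refine lintegral_congr_ae ?_
        filter_upwards [hΛ.ae_mem_convergenceSet] with σ hσ
        obtain ⟨e, he⟩ := (hσ.1 1).2
        obtain ⟨hD, hS⟩ := M.codingMap_shift x hσ he (hR (c e)).1 (hc e).1
        rw [tsum_eq_single e, Set.indicator_of_mem (mem_nextIs.2 he), hGF hD, hS]
        · simp only [g, hGF hσ]
        · intro e' hne
          refine Set.indicator_of_notMem (fun h => hne ?_) _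
          exact Option.some_injective _ ((mem_nextIs.1 h).symm.trans he)
    _ = ∑' e, ∫⁻ σ in nextIs e, g e σ ∂Λ := by
        rw [lintegral_tsum fun e =>
          (((hg e).mono past_le le_rfl).indicator (measurableSet_nextIs e)).aemeasurable]
        simp_rw [lintegral_indicator (measurableSet_nextIs _)]
    _ = ∑' e, ∫⁻ σ, ENNReal.ofReal (q e σ) * g e σ ∂Λ := by
        refine tsum_congr fun e => ?_
        rw [lintegral_mul_condExp_indicator past_le Λ (measurableSet_nextIs e) (hg e)]
    _ = ∫⁻ σ, ∑' e, ENNReal.ofReal (q e σ) * g e σ ∂Λ :=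
        (lintegral_tsum fun e =>
          ((hq e).ennreal_ofReal.mul ((hg e).mono past_le le_rfl)).aemeasurable).symm
    _ = ∫⁻ σ, markovOperator R.w R.p f (M.codingMap x σ) ∂Λ := by
        refine lintegral_congr_ae ?_
        filter_upwards [hΛ.ae_mem_convergenceSet, ae_all_iff.2 hΛ.condExp_eq] with σ hσ hcond
        refine M.tsum_edges_eq_markovOperator R (fun e' => (hR e').2) hinj hsurj f
          (M.codingMap_mem_closure x hσ) (fun e he => ?_) fun e he => ?_
        · have hmem : σ ∈ M.arrivesAt (M.i e) := ⟨hσ.1, he.symm⟩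
          simp only [q, g, hGF hσ]
          rw [hcond e, Set.indicator_of_mem hmem, M.pBar_eq_of_continuous (hR (c e)).2 (hc e).2
            (he ▸ M.codingMap_mem_closure x hσ)]
        · have hmem : σ ∉ M.arrivesAt (M.i e) := fun h => he h.2.symm
          simp only [q]
          rw [hcond e, Set.indicator_of_notMem hmem]
          simp

end IsAsymptoticState

end MarkovSystem

theorem theorem4 {K E' E : Type*} [MetricSpace K] [CompleteSpace K] [MeasurableSpace K]
    [BorelSpace K] {N : Set ℕ} (R : RandomDynamicalSystem K E') (M : MarkovSystem K E N)
    (hMR : M.IsAssociatedWith R) (hR : R.IsContinuous) (hM : M.IsUniformlyContinuous)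
    (hdom : M.HasDominatingMarkovChain) (x : ∀ j, M.V j) :
    M.IsConsistent x := by
  intro Λ hΛ
  have := hΛ.isProbabilityMeasure
  have hF := hΛ.aemeasurable_codingMap
  refine ⟨Measure.isProbabilityMeasure_map hF, fun f hf _ => ?_⟩
  rw [M.markovOperator_eq_of_isAssociatedWith R (fun e' => (hR e').2) hMR,
    lintegral_map' (MarkovSystem.measurable_markovOperator R hf).aemeasurable hF,
    lintegral_map' hf.aemeasurable hF, hΛ.lintegral_markovOperator_codingMap hMR hR hf]
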